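/- Let $P,Q$ be probability measures on a measurable space $\mathcal X$ and let $\varepsilon\ge 0$. A randomized mechanism $\mathcal M$ (a Markov kernel from datasets, i.e. elements of $\mathcal X^n$ or $\mathcal X^{\mathbb N}$, to an output space) is \emph{$\varepsilon$-DP} if $\Pr[\mathcal M(x)\in S]\le e^{\varepsilon}\Pr[\mathcal M(x')\in S]$ for all datasets $x,x'$ differing in one entry and all measurable $S$. An \emph{$\varepsilon$-DP e-variable for $P$ on $n$ samples} is the output $E=\mathcal M(X)\in[0,\infty)$ of an $\varepsilon$-DP mechanism with $\mathbb E^{P^n}[E]\le 1$, where $X\sim P^n$ and the expectation is over $X$ and the internal randomness of $\mathcal M$. With $\log 0=-\infty$ put $$\mathfrak R_{n,\varepsilon}(Q\,\|\,P)=\sup_{E}\frac{\mathbb E^{Q^n}[\log E]}{n},\qquad R_\varepsilon(Q\,\|\,P)=\lim_{n\to\infty}\mathfrak R_{n,\varepsilon}(Q\,\|\,P),$$ the supremum being over all $\varepsilon$-DP e-variables $E$ for $P$ on $n$ samples. Let $\mathcal M:\mathcal X^{\mathbb N}\to\mathcal O^{\mathbb N}$ be an $\varepsilon$-DP mechanism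 whose outputs $O_0,O_1,O_2,\dots$ are causal: for each $t$, the outputs $(O_0,\dots,O_t)$ depend (in joint law) only on the first $t$ records $x_1,\dots,x_t$. Write $\mathbb E^{P},\mathbb E^{Q}$ for expectations under the law of the output stream when the records are i.i.d. from $P$, respectively $Q$. Let $(\mathcal F_t)_{t\ge0}$ be a filtration with $\mathcal F_t\subseteq\sigma(O_0,\dots,O_t)$ (for instance $\mathcal F_t=\sigma(O_0,\dots,O_t)$). Let $(E_t)_{t\ge 0}$ be an $\varepsilon$-DP e-process for $P$, i.e. a $[0,\infty)$-valued $(\mathcal F_t)$-adapted process for which there is an $(\mathcal F_t)$-supermartingale $(M_t)_{t\ge0}$ under the output law for $P$ which is almost surely non-negative, has $\mathbb E^P[M_0]\le 1$, and satisfies $E_t\le M_t$ for all $t$ almost surely under that law. \textbf{Theorem.} The limit defining $R_\varepsilon(Q\,\|\,P)$ exists, and for every $(\mathcal F_t)$-stopping time $N$ for which there is a constant $N_{\max}<\infty$ with $N\le N_{\max}$ $Q$-almost surely (i.e. almost surely under the output law for $Q$), the expectation $\mathbb E^Q[\log E_N]\in[-\infty,\infty)$ is well defined (the positive part of $\log E_N$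 is integrable) and $$\mathbb E^Q[\log E_N]\le \mathbb E^Q[N]\cdot R_\varepsilon(Q\,\|\,P).$$ -/

import Mathlib

open MeasureTheory ProbabilityTheory Filter Topology
open scoped ENNReal NNReal

noncomputable section

namespace DPTest

/-- A randomized mechanism, given as a kernel from datasets (families of records indexed by `ι`,
finite for a batch and `ℕ` for a stream) to outputs, is `ε`-differentially private: changing a
single record changes the probability of any output event by a factor of at most `exp ε`. -/
def IsDP {ι X Y : Type*} [MeasurableSpace X] [MeasurableSpace Y]
    (ε : ℝ) (κ : Kernel (ι → X) Y) : Prop :=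
  ∀ x x' : ι → X, (∃ i, ∀ j, j ≠ i → x j = x' j) →
    ∀ S : Set Y, MeasurableSet S → κ x S ≤ ENNReal.ofReal (Real.exp ε) * κ x' S

/-- Expectation of an extended-real random variable, as the difference of the integrals of the
positive and the negative part. It is the usual expectation whenever the positive part has finite
integral (the value is then in `[-∞, ∞)`), and by the conventions of `EReal` it is `-∞` when both
parts have infinite integral. -/
def eExp {Ω : Type*} [MeasurableSpace Ω] (μ : Measure Ω) (f : Ω → EReal) : EReal :=
  ((∫⁻ ω, (f ω).toENNReal ∂μ : ℝ≥0∞) : EReal) - ((∫⁻ ω, (-(f ω)).toENNReal ∂μ : ℝ≥0∞) : EReal)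

/-- `ε`-DP e-variables for `P` on samples of size `n`: an `ε`-DP mechanism with non-negative
real output whose expectation, over an i.i.d. sample from `P` and the internal randomness, is at
most `1`. -/
structure IsDPEVariable {X : Type*} [MeasurableSpace X] {n : ℕ} (ε : ℝ) (P : Measure X)
    (κ : Kernel (Fin n → X) ℝ≥0) : Prop where
  markov : IsMarkovKernel κ
  dp : IsDP ε κ
  expectation_le_one : ∫⁻ y, (y : ℝ≥0∞) ∂(κ ∘ₘ Measure.pi (fun _ : Fin n => P)) ≤ 1

/-- The e-power `E^{Q^n}[log E]` of the e-variable produced by the mechanism `κ`, with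
`log 0 = -∞`. -/
def ePower {X : Type*} [MeasurableSpace X] {n : ℕ} (Q : Measure X)
    (κ : Kernel (Fin n → X) ℝ≥0) : EReal :=
  eExp (κ ∘ₘ Measure.pi (fun _ : Fin n => Q)) (fun y => ENNReal.log (y : ℝ≥0∞))

/-- The optimal e-power per observation at sample size `n`: the supremum of
`E^{Q^n}[log E] / n` over the `ε`-DP e-variables `E` for `P`. -/
def rateAt {X : Type*} [MeasurableSpace X] (ε : ℝ) (Q P : Measure X) (n : ℕ) : EReal :=
  ⨆ (κ : Kernel (Fin n → X) ℝ≥0) (_ : IsDPEVariable ε P κ), ePower Q κ / (n : EReal)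

/-- The optimal asymptotic rate `R_ε(Q ‖ P)`. -/
def rate {X : Type*} [MeasurableSpace X] (ε : ℝ) (Q P : Measure X) : EReal :=
  limUnder atTop (rateAt ε Q P)

/-- The law of the output stream of the mechanism `κ` when the records are i.i.d. from `P`. -/
def outputLaw {X O : Type*} [MeasurableSpace X] [MeasurableSpace O]
    (κ : Kernel (ℕ → X) (ℕ → O)) (P : Measure X) [IsProbabilityMeasure P] : Measure (ℕ → O) :=
  κ ∘ₘ Measure.infinitePi (fun _ : ℕ => P)

/-- The output filtration: at time `t` it is generated by the outputs `O_0, …, O_t`. -/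
def outputFiltration (O : Type*) [MeasurableSpace O] :
    Filtration ℕ (MeasurableSpace.pi : MeasurableSpace (ℕ → O)) :=
  Filtration.piLE (X := fun _ : ℕ => O)

/-- The outputs up to time `t` depend solely on the first `t` records (indexed by `i < t`) and on
the internal randomness: their joint law is unchanged when later records change. -/
def IsCausal {X O : Type*} [MeasurableSpace X] [MeasurableSpace O]
    (κ : Kernel (ℕ → X) (ℕ → O)) : Prop :=
  ∀ (t : ℕ) (x x' : ℕ → X), (∀ i, i < t → x i = x' i) →
    ∀ S : Set (ℕ → O), MeasurableSet[outputFiltration O t] S → κ x S = κ x' S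

/-- `M` is a test supermartingale for `μ`. -/
structure IsTestSupermartingale {Ω : Type*} {m : MeasurableSpace Ω} (𝓕 : Filtration ℕ m)
    (μ : Measure Ω) (M : ℕ → Ω → ℝ) : Prop where
  nonneg : ∀ᵐ ω ∂μ, ∀ t, 0 ≤ M t ω
  supermartingale : Supermartingale M 𝓕 μ
  initial_le_one : ∫ ω, M 0 ω ∂μ ≤ 1

/-- `E` is an e-process for `μ`: adapted, and almost surely dominated by a test
supermartingale. -/
structure IsEprocess {Ω : Type*} {m : MeasurableSpace Ω} (𝓕 : Filtration ℕ m)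
    (μ : Measure Ω) (E : ℕ → Ω → ℝ≥0) : Prop where
  adapted : ∀ t, Measurable[𝓕 t] (E t)
  dominated : ∃ M : ℕ → Ω → ℝ, IsTestSupermartingale 𝓕 μ M ∧
    ∀ᵐ ω ∂μ, ∀ t, (E t ω : ℝ) ≤ M t ω

/-- `E`, a sequence of functions of the output stream of the randomized mechanism `κ`, is an
`ε`-DP e-process for `P` with respect to the filtration `𝓕` of output events. Here `𝓕` may be the
whole output filtration or a smaller one, such as the one generated by `E` itself. -/
structure IsDPEprocess {X O : Type*} [MeasurableSpace X] [MeasurableSpace O] (ε : ℝ)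
    (P : Measure X) [IsProbabilityMeasure P] (κ : Kernel (ℕ → X) (ℕ → O))
    (𝓕 : Filtration ℕ (MeasurableSpace.pi : MeasurableSpace (ℕ → O)))
    (E : ℕ → (ℕ → O) → ℝ≥0) : Prop where
  markov : IsMarkovKernel κ
  dp : IsDP ε κ
  causal : IsCausal κ
  filtration_le : 𝓕 ≤ outputFiltration O
  eprocess : IsEprocess 𝓕 (outputLaw κ P) E

end DPTest

end

/-! Write `a n = optLog ε Q P n` for the best expected logarithm on `n` records. Given a stopping
time `τ ≤ b ≤ n`, run the e-process until `τ`, then a near-optimal e-variable on the remaining `n -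
τ` records, and multiply the two outputs. A given record matters either before `τ` or after it,
never for both factors, so the privacy costs do not add up and the product is again `ε`-DP
(`isDP_compose`). The remaining records are still i.i.d. given the stopped output
(`compProd_comp_pi`), so the mean under `P` stays at most `1` and expected logarithms add. With `L =
E^Q[log E_τ]` this gives `L + E^Q[a (n - τ)] ≤ a n` (`IsStoppedEVariable.add_integral_optLog_le`).

For deterministic `τ` this yields superadditivity of `a`, and Fekete's lemma gives `a n / n → R`;
group privacy and Jensen give `a n ≤ n ε`, so `R` is finite. For general `τ` with `L > 0` and `T =
E^Q[τ]`, the inequality is of renewal type and forces `a n ≥ (L / T) (n - b)`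
(`mul_sub_le_of_recursion`). Division by `n` gives `L / T ≤ R`. If `L ≤ 0` or the expectation is
`-∞`, the bound is trivial because `R ≥ 0`. -/

namespace DPTest

/-! ### Marginals and independent blocks of i.i.d. samples -/

section ProductMeasures

variable {X Y : Type*} [MeasurableSpace X] [MeasurableSpace Y]

lemma map_comp_infinitePi {ι κ : Type*} {e : κ → ι} (he : Function.Injective e)
    (P : Measure X) [IsProbabilityMeasure P] :
    (Measure.infinitePi (fun _ : ι => P)).map (fun x j => x (e j)) =
      Measure.infinitePi (fun _ : κ => P) := by
  have h := (iIndepFun_infinitePi (P := fun _ : ι => P) (X := fun _ x => x)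
    (fun _ => measurable_id)).precomp he
  rw [h.map_fun_eq_infinitePi_map (fun j => measurable_pi_apply (e j))]
  congr with j : 1
  exact Measure.infinitePi_map_eval (fun _ : ι => P) (e j)

lemma map_comp_pi {n k : ℕ} {e : Fin k → Fin n} (he : Function.Injective e)
    (P : Measure X) [IsProbabilityMeasure P] :
    (Measure.pi (fun _ : Fin n => P)).map (fun x j => x (e j)) = Measure.pi (fun _ => P) := by
  simpa only [Measure.infinitePi_eq_pi] using map_comp_infinitePi he P

lemma map_comp_infinitePi_pi {n : ℕ} (P : Measure X) [IsProbabilityMeasure P] :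
    (Measure.infinitePi (fun _ : ℕ => P)).map (fun x (j : Fin n) => x j) =
      Measure.pi (fun _ => P) := by
  simpa only [Measure.infinitePi_eq_pi] using map_comp_infinitePi Fin.val_injective P

/-- Functions of disjoint blocks of an i.i.d. sample are independent. -/
lemma lintegral_pi_mul_of_disjoint_blocks {n m : ℕ} (P : Measure X) [IsProbabilityMeasure P]
    {f g : (Fin n → X) → ℝ≥0∞} (hf : Measurable f) (hg : Measurable g)
    (hfd : ∀ x x' : Fin n → X, (∀ i : Fin n, (i : ℕ) < m → x i = x' i) → f x = f x')
    (hgd : ∀ x x' : Fin n → X, (∀ i : Fin n, m ≤ (i : ℕ) → x i = x' i) → g x = g x') :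
    ∫⁻ x, f x * g x ∂(Measure.pi fun _ => P) =
      (∫⁻ x, f x ∂(Measure.pi fun _ => P)) * ∫⁻ x, g x ∂(Measure.pi fun _ => P) := by
  classical
  obtain ⟨x₀⟩ := nonempty_of_isProbabilityMeasure P
  set S : Finset (Fin n) := Finset.univ.filter fun i => (i : ℕ) < m
  set T : Finset (Fin n) := Finset.univ.filter fun i => m ≤ (i : ℕ)
  have hST : Disjoint S T := by
    rw [Finset.disjoint_left]; intro i; simp only [S, T, Finset.mem_filter]; omega
  have hind := (iIndepFun_pi (μ := fun _ : Fin n => P) (X := fun _ x => x)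
    (fun _ => aemeasurable_id)).indepFun_finset S T hST (fun i => measurable_pi_apply i)
  -- Filling the coordinates outside a block with `x₀` shows that a function insensitive to them
  -- factors through the restriction to the block.
  let ext (R : Finset (Fin n)) : (R → X) → Fin n → X := fun z i =>
    if h : i ∈ R then z ⟨i, h⟩ else x₀
  have hext (R : Finset (Fin n)) : Measurable (ext R) := by
    refine measurable_pi_lambda _ fun i => ?_
    by_cases h : i ∈ R
    · simpa only [ext, h, dite_true] using measurable_pi_apply _
    · simp only [ext, h, dite_false, measurable_const]
  have hf' : f = (f ∘ ext S) ∘ fun x (i : S) => x i := by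
    funext x
    refine hfd _ _ fun i hi => ?_
    simp [ext, S, hi]
  have hg' : g = (g ∘ ext T) ∘ fun x (i : T) => x i := by
    funext x
    refine hgd _ _ fun i hi => ?_
    simp [ext, T, hi]
  have hfg : IndepFun f g (Measure.pi fun _ : Fin n => P) := by
    rw [hf', hg']
    exact hind.comp (hf.comp (hext S)) (hg.comp (hext T))
  exact lintegral_mul_eq_lintegral_mul_lintegral_of_indepFun hf hg hfg

end ProductMeasures

/-! ### Consequences of differential privacy -/

section Privacy

variable {X Y : Type*} [MeasurableSpace X] [MeasurableSpace Y]

variable {ε : ℝ}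

/-- Differential privacy bounds the change of integrals of non-negative functions. -/
lemma IsDP.lintegral_le {ι : Type*} {κ : Kernel (ι → X) Y} (h : IsDP ε κ) {x x' : ι → X}
    (hx : ∃ i, ∀ j, j ≠ i → x j = x' j) (f : Y → ℝ≥0∞) :
    ∫⁻ y, f y ∂κ x ≤ ENNReal.ofReal (Real.exp ε) * ∫⁻ y, f y ∂κ x' := by
  rw [← smul_eq_mul, ← lintegral_smul_measure]
  refine lintegral_mono' (Measure.le_intro fun S hS _ => ?_) le_rfl
  simpa using h x x' hx S hS

lemma IsDP.map {ι Z : Type*} [MeasurableSpace Z] {κ : Kernel (ι → X) Y} (h : IsDP ε κ)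
    {f : Y → Z} (hf : Measurable f) : IsDP ε (κ.map f) := by
  intro x x' hx S hS
  rw [Kernel.map_apply' _ hf _ hS, Kernel.map_apply' _ hf _ hS]
  exact h x x' hx _ (hf hS)

/-- Group privacy. -/
lemma IsDP.le_pow {n : ℕ} {κ : Kernel (Fin n → X) Y} (h : IsDP ε κ) (x x' : Fin n → X)
    {S : Set Y} (hS : MeasurableSet S) :
    κ x S ≤ ENNReal.ofReal (Real.exp ε) ^ n * κ x' S := by
  -- Hybrid argument: the records are replaced one at a time, each at the cost of one factor `exp
  -- ε`.
  have key : ∀ k ≤ n, κ x S ≤ ENNReal.ofReal (Real.exp ε) ^ k *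
      κ (fun i => if (i : ℕ) < k then x' i else x i) S := by
    intro k
    induction k with
    | zero => simp
    | succ k ih =>
      intro hk
      refine (ih (by omega)).trans ?_
      rw [pow_succ, mul_assoc]
      gcongr
      refine h _ _ ⟨⟨k, hk⟩, fun j hj => ?_⟩ S hS
      have : (j : ℕ) ≠ k := fun h => hj (Fin.ext h)
      have h2 : (j : ℕ) < k ↔ (j : ℕ) < k + 1 := by omega
      simp only [h2]
  simpa using key n le_rfl

/-- Group privacy compares every pair of datasets, so it survives averaging one of them over `Q^n`
and the other independently over `P^n`. This is what transfers moment bounds from `P` to `Q`. -/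
lemma IsDP.comp_pi_le {n : ℕ} {κ : Kernel (Fin n → X) Y} (h : IsDP ε κ)
    (P Q : Measure X) [IsProbabilityMeasure P] [IsProbabilityMeasure Q] :
    κ ∘ₘ Measure.pi (fun _ : Fin n => Q) ≤
      ENNReal.ofReal (Real.exp ε) ^ n • (κ ∘ₘ Measure.pi (fun _ : Fin n => P)) := by
  refine Measure.le_intro fun S hS _ => ?_
  rw [Measure.smul_apply, smul_eq_mul, Measure.bind_apply hS κ.aemeasurable,
    Measure.bind_apply hS κ.aemeasurable]
  have h1 : ∀ x', ∫⁻ x, κ x S ∂(Measure.pi fun _ : Fin n => Q) ≤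
      ENNReal.ofReal (Real.exp ε) ^ n * κ x' S := fun x' => by
    refine (lintegral_mono fun x => h.le_pow x x' hS).trans ?_
    simp
  calc _ = ∫⁻ _, ∫⁻ x, κ x S ∂(Measure.pi fun _ : Fin n => Q) ∂(Measure.pi fun _ : Fin n => P) := by
        simp
    _ ≤ ∫⁻ x', ENNReal.ofReal (Real.exp ε) ^ n * κ x' S ∂(Measure.pi fun _ : Fin n => P) :=
        lintegral_mono h1
    _ = _ := lintegral_const_mul _ (κ.measurable_coe hS)

end Privacy

/-! ### Expected logarithms: from extended-real to Bochner integrals -/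

section Expectation

/-- `log` is finite almost everywhere and integrable. -/
structure LogIntegrable (μ : Measure ℝ≥0) : Prop where
  pos : ∀ᵐ y ∂μ, 0 < y
  integrable : Integrable (fun y : ℝ≥0 => Real.log y) μ

lemma toENNReal_log_coe {y : ℝ≥0} (hy : 0 < y) :
    (ENNReal.log (y : ℝ≥0∞)).toENNReal = ENNReal.ofReal (Real.log y) := by
  rw [ENNReal.log_pos_real (by simpa using hy.ne') (by simp)]
  simp

lemma toENNReal_neg_log_coe {y : ℝ≥0} (hy : 0 < y) :
    (-ENNReal.log (y : ℝ≥0∞)).toENNReal = ENNReal.ofReal (-Real.log y) := by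
  rw [ENNReal.log_pos_real (by simpa using hy.ne') (by simp), ← EReal.coe_neg]
  simp

lemma toENNReal_log_coe_le (y : ℝ≥0) : (ENNReal.log (y : ℝ≥0∞)).toENNReal ≤ y := by
  rcases eq_zero_or_pos y with rfl | hy
  · simp
  · rw [toENNReal_log_coe hy]
    refine (ENNReal.ofReal_le_ofReal (Real.log_le_self y.2)).trans ?_
    simp

lemma lintegral_toENNReal_log_ne_top {μ : Measure ℝ≥0} (h : ∫⁻ y, (y : ℝ≥0∞) ∂μ ≠ ∞) :
    ∫⁻ y : ℝ≥0, (ENNReal.log (y : ℝ≥0∞)).toENNReal ∂μ ≠ ∞ :=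
  ne_top_of_le_ne_top h (lintegral_mono toENNReal_log_coe_le)

lemma LogIntegrable.eExp_eq {μ : Measure ℝ≥0} (h : LogIntegrable μ) :
    eExp μ (fun y => ENNReal.log (y : ℝ≥0∞)) = (∫ y, Real.log y ∂μ : ℝ) := by
  rw [eExp, integral_eq_lintegral_pos_part_sub_lintegral_neg_part h.integrable,
    lintegral_congr_ae (h.pos.mono fun y hy => toENNReal_log_coe hy),
    lintegral_congr_ae (h.pos.mono fun y hy => toENNReal_neg_log_coe hy)]
  have h1 := h.integrable.lintegral_lt_top.ne
  have h2 := h.integrable.neg.lintegral_lt_top.ne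
  simp only [Pi.neg_apply] at h2
  rw [EReal.coe_sub, EReal.coe_ennreal_toReal h1, EReal.coe_ennreal_toReal h2]

/-- A finite mean controls the positive part through `log y ≤ y`, so only an infinite negative part
can destroy integrability, and that makes the expectation `-∞`. -/
lemma logIntegrable_of_eExp_ne_bot {μ : Measure ℝ≥0} (h : ∫⁻ y, (y : ℝ≥0∞) ∂μ ≠ ∞)
    (hb : eExp μ (fun y => ENNReal.log (y : ℝ≥0∞)) ≠ ⊥) : LogIntegrable μ := by
  have hp := lintegral_toENNReal_log_ne_top h
  have hn : ∫⁻ y : ℝ≥0, (-ENNReal.log (y : ℝ≥0∞)).toENNReal ∂μ ≠ ∞ := by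
    intro ht
    apply hb
    rw [eExp, ht]
    simp
  have hmeas : Measurable fun y : ℝ≥0 => (-ENNReal.log (y : ℝ≥0∞)).toENNReal := by fun_prop
  have hpos : ∀ᵐ y ∂μ, 0 < y := by
    filter_upwards [ae_lt_top hmeas hn] with y hy
    rw [pos_iff_ne_zero]
    rintro rfl
    simp at hy
  refine ⟨hpos, ?_, ?_⟩
  · exact (Real.measurable_log.comp measurable_coe_nnreal_real).aestronglyMeasurable
  · rw [hasFiniteIntegral_iff_enorm]
    have : ∫⁻ y : ℝ≥0, ‖Real.log y‖ₑ ∂μ =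
        ∫⁻ y : ℝ≥0, (ENNReal.log (y : ℝ≥0∞)).toENNReal + (-ENNReal.log (y : ℝ≥0∞)).toENNReal ∂μ := by
      refine lintegral_congr_ae (hpos.mono fun y hy => ?_)
      simp only
      rw [toENNReal_log_coe hy, toENNReal_neg_log_coe hy, Real.enorm_eq_ofReal_abs]
      rcases le_total 0 (Real.log y) with h0 | h0
      · rw [abs_of_nonneg h0, ENNReal.ofReal_of_nonpos (neg_nonpos.2 h0), add_zero]
      · rw [abs_of_nonpos h0, ENNReal.ofReal_of_nonpos h0, zero_add]
    rw [this, lintegral_add_right _ hmeas]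
    exact (ENNReal.add_ne_top.2 ⟨hp, hn⟩).lt_top

/-- Jensen's inequality for the logarithm. -/
lemma LogIntegrable.integral_le {μ : Measure ℝ≥0} [IsProbabilityMeasure μ]
    (h : LogIntegrable μ) {a : ℝ}
    (ha : ∫⁻ y, (y : ℝ≥0∞) ∂μ ≤ ENNReal.ofReal (Real.exp a)) : ∫ y, Real.log y ∂μ ≤ a := by
  have hint : Integrable (fun y : ℝ≥0 => (y : ℝ)) μ := by
    refine ⟨measurable_coe_nnreal_real.aestronglyMeasurable, ?_⟩
    rw [hasFiniteIntegral_iff_enorm]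
    simpa using ha.trans_lt ENNReal.ofReal_lt_top
  have hle : ∫ y : ℝ≥0, (y : ℝ) ∂μ ≤ Real.exp a := by
    rw [integral_eq_lintegral_of_nonneg_ae (ae_of_all _ fun y => y.2)
      measurable_coe_nnreal_real.aestronglyMeasurable]
    refine ENNReal.toReal_le_of_le_ofReal (Real.exp_pos a).le ?_
    simpa using ha
  calc ∫ y, Real.log y ∂μ ≤ ∫ y : ℝ≥0, (Real.exp (-a) * (y : ℝ) + (a - 1)) ∂μ := by
        refine integral_mono_ae h.integrable ((hint.const_mul _).add (integrable_const _))
          (h.pos.mono fun y hy => ?_)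
        have hy' : (0 : ℝ) < y := hy
        -- The tangent line to `log` at `exp a`.
        have := Real.log_le_sub_one_of_pos (mul_pos (Real.exp_pos (-a)) hy')
        rw [Real.log_mul (Real.exp_pos _).ne' hy'.ne', Real.log_exp] at this
        simp only
        linarith
    _ = Real.exp (-a) * ∫ y : ℝ≥0, (y : ℝ) ∂μ + (a - 1) := by
        rw [integral_add (hint.const_mul _) (integrable_const _), integral_const_mul]
        simp
    _ ≤ Real.exp (-a) * Real.exp a + (a - 1) := by gcongr
    _ = a := by rw [← Real.exp_add]; simp

end Expectation

/-! ### Continuing a stopped mechanism on the remaining records -/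

section Composition

variable {X : Type*} [MeasurableSpace X]

/-- The records of a dataset of size `n` from index `m` on. -/
def tailRecords {n : ℕ} (m : ℕ) (x : Fin n → X) : Fin (n - m) → X :=
  -- For `m ≥ n` the truncated `n - m` is `0` and the tail is the empty dataset.
  fun j => x ⟨m + j, by omega⟩

@[fun_prop]
lemma measurable_tailRecords {n : ℕ} (m : ℕ) :
    Measurable (tailRecords m : (Fin n → X) → Fin (n - m) → X) :=
  measurable_pi_lambda _ fun _ => measurable_pi_apply _

lemma map_tailRecords {n : ℕ} (m : ℕ) (P : Measure X) [IsProbabilityMeasure P] :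
    (Measure.pi fun _ : Fin n => P).map (tailRecords m) = Measure.pi fun _ => P :=
  map_comp_pi (e := fun j : Fin (n - m) => (⟨m + j, by omega⟩ : Fin n))
    (fun a b h => by simpa [Fin.ext_iff] using h) P

lemma tailRecords_congr {X : Type*} {n : ℕ} {m : ℕ} {x x' : Fin n → X}
    (h : ∀ i : Fin n, m ≤ (i : ℕ) → x i = x' i) : tailRecords m x = tailRecords m x' :=
  funext fun _ => h _ (Nat.le_add_right _ _)

/-- A mechanism on `n` records whose output is a stopping time together with the value of an
e-variable that has been computed from the records seen before the stopping time. -/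
structure IsStoppedEVariable {n : ℕ} (ε : ℝ) (P : Measure X)
    (K : Kernel (Fin n → X) (ℕ × ℝ≥0)) : Prop where
  markov : IsMarkovKernel K
  dp : IsDP ε K
  causal : ∀ (m : ℕ) (x x' : Fin n → X), (∀ i : Fin n, (i : ℕ) < m → x i = x' i) →
    ∀ S : Set (ℕ × ℝ≥0), MeasurableSet S → (∀ p ∈ S, p.1 ≤ m) → K x S = K x' S
  expectation_le_one : ∫⁻ p, (p.2 : ℝ≥0∞) ∂(K ∘ₘ Measure.pi (fun _ : Fin n => P)) ≤ 1

variable {n : ℕ}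

/-- The kernel that runs the mechanism for `n - m` records on the records after the stopping
time `m`. -/
noncomputable def continuation (κ : ∀ m, Kernel (Fin m → X) ℝ≥0) :
    Kernel ((Fin n → X) × ℕ × ℝ≥0) ℝ≥0 :=
  Kernel.comap (γ := (Fin n → X) × ℕ × ℝ≥0) (α := (Fin n → X) × ℕ)
    ⟨fun q => κ (n - q.2) (tailRecords q.2 q.1),
      measurable_from_prod_countable_left fun m =>
        (κ (n - m)).measurable.comp (measurable_tailRecords m)⟩
    (fun q => (q.1, q.2.1)) (by fun_prop)

lemma continuation_apply (κ : ∀ m, Kernel (Fin m → X) ℝ≥0) (q : (Fin n → X) × ℕ × ℝ≥0) :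
    continuation κ q = κ (n - q.2.1) (tailRecords q.2.1 q.1) := rfl

/-- The law of the output of the continuation after the stopping time. -/
noncomputable def continuationLaw (n : ℕ) (P : Measure X) (κ : ∀ m, Kernel (Fin m → X) ℝ≥0) :
    Kernel (ℕ × ℝ≥0) ℝ≥0 where
  toFun p := κ (n - p.1) ∘ₘ Measure.pi fun _ => P
  measurable' := (measurable_from_nat (f := fun m : ℕ => κ (n - m) ∘ₘ Measure.pi fun _ => P)).comp
    measurable_fst

lemma continuationLaw_apply (P : Measure X) (κ : ∀ m, Kernel (Fin m → X) ℝ≥0) (p : ℕ × ℝ≥0) :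
    continuationLaw n P κ p = κ (n - p.1) ∘ₘ Measure.pi fun _ => P := rfl

instance (κ : ∀ m, Kernel (Fin m → X) ℝ≥0) [∀ m, IsMarkovKernel (κ m)] :
    IsMarkovKernel (continuation (n := n) κ) :=
  ⟨fun q => by rw [continuation_apply]; infer_instance⟩

instance (P : Measure X) [IsProbabilityMeasure P] (κ : ∀ m, Kernel (Fin m → X) ℝ≥0)
    [∀ m, IsMarkovKernel (κ m)] : IsMarkovKernel (continuationLaw n P κ) :=
  ⟨fun p => by rw [continuationLaw_apply]; infer_instance⟩

/-- Run the stopped mechanism `K`, then `κ (n - m)` on the `n - m` records that are left, and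
multiply the two outputs. -/
noncomputable def compose (K : Kernel (Fin n → X) (ℕ × ℝ≥0))
    (κ : ∀ m, Kernel (Fin m → X) ℝ≥0) : Kernel (Fin n → X) ℝ≥0 :=
  (K ⊗ₖ continuation κ).map fun q => q.1.2 * q.2

variable {ε : ℝ} {P Q : Measure X} [IsProbabilityMeasure Q]
  {K : Kernel (Fin n → X) (ℕ × ℝ≥0)} {κ : ∀ m, Kernel (Fin m → X) ℝ≥0}

lemma IsStoppedEVariable.restrict_eq (hK : IsStoppedEVariable ε P K) {m : ℕ} {x x' : Fin n → X}
    (h : ∀ i : Fin n, (i : ℕ) < m → x i = x' i) :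
    (K x).restrict {p | p.1 ≤ m} = (K x').restrict {p | p.1 ≤ m} := by
  have hm : MeasurableSet {p : ℕ × ℝ≥0 | p.1 ≤ m} := measurable_fst (measurableSet_Iic (a := m))
  ext S hS
  rw [Measure.restrict_apply hS, Measure.restrict_apply hS]
  exact hK.causal m x x' h _ (hS.inter hm) fun p hp => hp.2

/-- Let the datasets differ at index `i`, and split by the stopping time. If it is at most `i`, the
stopped output has the same law for both by causality, and only the continuation sees the change. If
it exceeds `i`, the continuation gets identical data and only `K` sees the change. Either way a
single factor `exp ε` is paid. -/
lemma isDP_compose (hK : IsStoppedEVariable ε P K)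
    [∀ m, IsMarkovKernel (κ m)] (hκ : ∀ m, IsDP ε (κ m)) : IsDP ε (compose K κ) := by
  have := hK.markov
  have hf : Measurable fun q : (ℕ × ℝ≥0) × ℝ≥0 => q.1.2 * q.2 := by fun_prop
  rintro x x' ⟨i, hi⟩ S hS
  rw [compose, Kernel.map_apply' _ hf _ hS, Kernel.map_apply' _ hf _ hS,
    Kernel.compProd_apply (hf hS), Kernel.compProd_apply (hf hS)]
  set g : (Fin n → X) → ℕ × ℝ≥0 → ℝ≥0∞ := fun x p =>
    continuation κ (x, p) (Prod.mk p ⁻¹' ((fun q : (ℕ × ℝ≥0) × ℝ≥0 => q.1.2 * q.2) ⁻¹' S)) with hg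
  set c := ENNReal.ofReal (Real.exp ε)
  set A : Set (ℕ × ℝ≥0) := {p | p.1 ≤ i}
  have hA : MeasurableSet A := measurable_fst (measurableSet_Iic (a := (i : ℕ)))
  have h1 : ∫⁻ p in A, g x p ∂K x ≤ c * ∫⁻ p in A, g x' p ∂K x' := by
    rw [hK.restrict_eq (x := x) (x' := x') fun j hj => hi j (by rintro rfl; exact lt_irrefl _ hj),
      ← lintegral_const_mul' _ _ ENNReal.ofReal_ne_top]
    refine setLIntegral_mono' hA fun p hp => ?_
    simp only [hg, continuation_apply]
    refine hκ (n - p.1) _ _ ⟨⟨i - p.1, ?_⟩, fun j hj => hi _ ?_⟩ _ (measurable_prodMk_left (hf hS))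
    · have : p.1 ≤ i := hp
      omega
    · have : p.1 ≤ i := hp
      simp only [ne_eq, Fin.ext_iff] at hj ⊢
      omega
  have h2 : ∫⁻ p in Aᶜ, g x p ∂K x ≤ c * ∫⁻ p in Aᶜ, g x' p ∂K x' := by
    rw [← lintegral_indicator hA.compl, ← lintegral_indicator hA.compl]
    refine le_of_eq_of_le ?_ (hK.dp.lintegral_le ⟨i, hi⟩ _)
    refine lintegral_congr fun p => ?_
    by_cases hp : p ∈ A
    · simp [hp]
    · have hp' : ¬ p.1 ≤ i := hp
      simp only [Set.mem_compl_iff, hp, not_false_eq_true, Set.indicator_of_mem, hg,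
        continuation_apply]
      rw [tailRecords_congr fun j hj => hi j (by rintro rfl; exact hp' hj)]
  rw [← lintegral_add_compl _ hA, ← lintegral_add_compl (g x') hA, mul_add]
  exact add_le_add h1 h2

/-- A strong Markov property: on the event that the stopping time is `m`, `K` depends on the records
before `m` and the continuation on those from `m` on. These blocks are independent, so the
continuation may be fed a fresh i.i.d. sample. -/
lemma compProd_comp_pi (hK : IsStoppedEVariable ε P K) [∀ m, IsMarkovKernel (κ m)] :
    (K ⊗ₖ continuation κ) ∘ₘ Measure.pi (fun _ : Fin n => Q) =
      (K ∘ₘ Measure.pi (fun _ : Fin n => Q)) ⊗ₘ continuationLaw n Q κ := by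
  have := hK.markov
  refine Measure.ext_prod fun {s t} hs ht => ?_
  have hpart (m : ℕ) : MeasurableSet {p : ℕ × ℝ≥0 | p.1 = m} :=
    measurable_fst (measurableSet_singleton m)
  -- Decomposition over the countably many values of the stopping time, used on both sides of the
  -- identity.
  have hsplit (μ : Measure (ℕ × ℝ≥0)) (f : ℕ → ℝ≥0∞) :
      ∫⁻ p in s, f p.1 ∂μ = ∑' m, μ (s ∩ {p | p.1 = m}) * f m := by
    have hU : s = ⋃ m : ℕ, s ∩ {p | p.1 = m} := by ext; simp
    conv_lhs => rw [hU]
    rw [lintegral_iUnion (fun m => hs.inter (hpart m))]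
    · refine tsum_congr fun m => ?_
      rw [setLIntegral_congr_fun (g := fun _ => f m) (hs.inter (hpart m))
        fun p hp => by simp only [show p.1 = m from hp.2]]
      rw [setLIntegral_const, mul_comm]
    · intro a b hab
      refine Set.disjoint_left.2 fun p hp hp' => hab ?_
      exact hp.2.symm.trans hp'.2
  rw [Measure.bind_apply (hs.prod ht) (Kernel.aemeasurable _), Measure.compProd_apply_prod hs ht]
  simp only [continuationLaw_apply]
  rw [hsplit _ fun m => (κ (n - m) ∘ₘ Measure.pi fun _ => Q) t]
  have hx (x : Fin n → X) : (K ⊗ₖ continuation κ) x (s ×ˢ t) =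
      ∑' m, K x (s ∩ {p | p.1 = m}) * κ (n - m) (tailRecords m x) t := by
    rw [Kernel.compProd_apply_prod hs ht]
    simp only [continuation_apply]
    exact hsplit _ fun m => κ (n - m) (tailRecords m x) t
  simp only [hx]
  have hm1 (m : ℕ) : Measurable fun x => K x (s ∩ {p | p.1 = m}) :=
    K.measurable_coe (hs.inter (hpart m))
  have hm2 (m : ℕ) : Measurable fun x : Fin n → X => κ (n - m) (tailRecords m x) t :=
    ((κ (n - m)).measurable_coe ht).comp (measurable_tailRecords m)
  rw [lintegral_tsum (f := fun m x => K x (s ∩ {p | p.1 = m}) * κ (n - m) (tailRecords m x) t)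
    fun m => ((hm1 m).mul (hm2 m)).aemeasurable]
  refine tsum_congr fun m => ?_
  rw [lintegral_pi_mul_of_disjoint_blocks (m := m) Q (hm1 m) (hm2 m)
    (fun x x' h => hK.causal m x x' h _ (hs.inter (hpart m)) fun p hp => hp.2.le)
    (fun x x' h => by rw [tailRecords_congr h]),
    Measure.bind_apply (hs.inter (hpart m)) K.aemeasurable,
    Measure.bind_apply ht (Kernel.aemeasurable _), ← map_tailRecords (n := n) m Q,
    lintegral_map ((κ (n - m)).measurable_coe ht) (measurable_tailRecords m)]

lemma compose_comp_pi (hK : IsStoppedEVariable ε P K) [∀ m, IsMarkovKernel (κ m)] :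
    compose K κ ∘ₘ Measure.pi (fun _ : Fin n => Q) =
      ((K ∘ₘ Measure.pi (fun _ : Fin n => Q)) ⊗ₘ continuationLaw n Q κ).map
        fun q => q.1.2 * q.2 := by
  rw [← compProd_comp_pi hK, Measure.map_comp _ _ (by fun_prop), compose]

/-- Given the stopped output, the second factor has mean at most `1` under `P`, whatever the
stopping time. -/
lemma IsStoppedEVariable.compose [IsProbabilityMeasure P] (hK : IsStoppedEVariable ε P K)
    (hκ : ∀ m, IsDPEVariable ε P (κ m)) : IsDPEVariable ε P (compose K κ) := by
  have := hK.markov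
  have := fun m => (hκ m).markov
  refine ⟨Kernel.IsMarkovKernel.map _ (by fun_prop), isDP_compose hK fun m => (hκ m).dp, ?_⟩
  rw [compose_comp_pi hK, lintegral_map (by fun_prop) (by fun_prop),
    Measure.lintegral_compProd (by fun_prop)]
  refine le_trans (lintegral_mono fun p => ?_) hK.expectation_le_one
  simp only [ENNReal.coe_mul]
  rw [lintegral_const_mul _ (by fun_prop)]
  exact mul_le_of_le_one_right' (hκ (n - p.1)).expectation_le_one

/-- Only the values `f 0, …, f n` occur, so the function is bounded. -/
lemma integrable_comp_fst_sub {n : ℕ} {μ : Measure (ℕ × ℝ≥0)} [IsProbabilityMeasure μ] (f : ℕ → ℝ) :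
    Integrable (fun p : ℕ × ℝ≥0 => f (n - p.1)) μ := by
  refine Integrable.of_bound (C := ∑ m ∈ Finset.range (n + 1), ‖f m‖)
    ((measurable_from_nat (f := fun m => f (n - m))).comp measurable_fst).aestronglyMeasurable
    (ae_of_all _ fun p => ?_)
  exact Finset.single_le_sum (f := fun m => ‖f m‖) (fun _ _ => norm_nonneg _)
    (Finset.mem_range.2 (by omega : n - p.1 < n + 1))

lemma logIntegrable_compose (hK : IsStoppedEVariable ε P K) [∀ m, IsMarkovKernel (κ m)]
    (hlog : LogIntegrable ((K ∘ₘ Measure.pi (fun _ : Fin n => Q)).map Prod.snd))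
    (hκ : ∀ m, LogIntegrable (κ m ∘ₘ Measure.pi (fun _ : Fin m => Q))) :
    LogIntegrable (compose K κ ∘ₘ Measure.pi (fun _ : Fin n => Q)) ∧
    ∫ y, Real.log y ∂(compose K κ ∘ₘ Measure.pi (fun _ : Fin n => Q)) =
      ∫ y, Real.log y ∂((K ∘ₘ Measure.pi (fun _ : Fin n => Q)).map Prod.snd) +
      ∫ p, (∫ y, Real.log y ∂(κ (n - p.1) ∘ₘ Measure.pi (fun _ => Q)))
        ∂(K ∘ₘ Measure.pi (fun _ : Fin n => Q)) := by
  have := hK.markov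
  set μ := K ∘ₘ Measure.pi (fun _ : Fin n => Q)
  set ξ := continuationLaw n Q κ
  have hpos : ∀ᵐ p ∂μ, 0 < p.2 := ae_of_ae_map (by fun_prop) hlog.pos
  have hmlog : Measurable fun y : ℝ≥0 => Real.log y := by fun_prop
  have hint : Integrable (fun p : ℕ × ℝ≥0 => Real.log p.2) μ :=
    hlog.integrable.comp_measurable measurable_snd
  have hint1 : Integrable (fun q : (ℕ × ℝ≥0) × ℝ≥0 => Real.log q.1.2) (μ ⊗ₘ ξ) := by
    have : μ = (μ ⊗ₘ ξ).map Prod.fst := (Measure.fst_compProd μ ξ).symm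
    rw [this] at hint
    exact hint.comp_measurable measurable_fst
  have hint2 : Integrable (fun q : (ℕ × ℝ≥0) × ℝ≥0 => Real.log q.2) (μ ⊗ₘ ξ) := by
    rw [Measure.integrable_compProd_iff 
      (f := fun q : (ℕ × ℝ≥0) × ℝ≥0 => Real.log q.2)
      (hmlog.comp measurable_snd).aestronglyMeasurable]
    exact ⟨ae_of_all _ fun p => (hκ (n - p.1)).integrable,
      integrable_comp_fst_sub fun m => ∫ y, ‖Real.log y‖ ∂(κ m ∘ₘ Measure.pi (fun _ => Q))⟩
  have hpos2 : ∀ᵐ q ∂(μ ⊗ₘ ξ), 0 < q.1.2 ∧ 0 < q.2 := by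
    rw [Measure.ae_compProd_iff]
    · filter_upwards [hpos] with p hp
      filter_upwards [(hκ (n - p.1)).pos] with y hy
      exact ⟨hp, hy⟩
    · exact (measurableSet_lt measurable_const (by fun_prop)).inter
        (measurableSet_lt measurable_const (by fun_prop))
  have hae : (fun q : (ℕ × ℝ≥0) × ℝ≥0 => Real.log ((q.1.2 * q.2 : ℝ≥0) : ℝ)) =ᵐ[μ ⊗ₘ ξ]
      fun q => Real.log q.1.2 + Real.log q.2 := by
    filter_upwards [hpos2] with q hq
    rw [NNReal.coe_mul, Real.log_mul (NNReal.coe_pos.2 hq.1).ne' (NNReal.coe_pos.2 hq.2).ne']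
  have hmul : Measurable fun q : (ℕ × ℝ≥0) × ℝ≥0 => q.1.2 * q.2 := by fun_prop
  rw [compose_comp_pi hK]
  refine ⟨⟨?_, ?_⟩, ?_⟩
  · rw [ae_map_iff hmul.aemeasurable measurableSet_Ioi]
    filter_upwards [hpos2] with q hq
    exact mul_pos hq.1 hq.2
  · rw [integrable_map_measure hmlog.aestronglyMeasurable hmul.aemeasurable]
    exact (hint1.add hint2).congr hae.symm
  · rw [integral_map hmul.aemeasurable hmlog.aestronglyMeasurable, integral_congr_ae hae,
      integral_add hint1 hint2, Measure.integral_compProd hint1, Measure.integral_compProd hint2,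
      integral_map measurable_snd.aemeasurable hmlog.aestronglyMeasurable]
    simp
    rfl

end Composition

/-! ### The optimal e-power: finiteness, superadditivity and the limit -/

section Rate

variable {X : Type*} [MeasurableSpace X]

variable {n : ℕ} {ε : ℝ} {P Q : Measure X}

lemma IsDP.lintegral_comp_pi_le {Y : Type*} [MeasurableSpace Y]
    [IsProbabilityMeasure P] [IsProbabilityMeasure Q]
    {κ : Kernel (Fin n → X) Y} (h : IsDP ε κ) {f : Y → ℝ≥0∞}
    (hf : ∫⁻ y, f y ∂(κ ∘ₘ Measure.pi (fun _ : Fin n => P)) ≤ 1) :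
    ∫⁻ y, f y ∂(κ ∘ₘ Measure.pi (fun _ : Fin n => Q)) ≤ ENNReal.ofReal (Real.exp (n * ε)) := by
  refine (lintegral_mono' (h.comp_pi_le P Q) le_rfl).trans ?_
  rw [lintegral_smul_measure, smul_eq_mul, Real.exp_nat_mul,
    ENNReal.ofReal_pow (Real.exp_pos _).le]
  exact mul_le_of_le_one_right' hf

/-- The trivial competitor: it makes the set defining `optLog` nonempty and `optLog` non-negative.
-/
lemma isDPEVariable_const_one [IsProbabilityMeasure P] (hε : 0 ≤ ε) :
    IsDPEVariable ε P (Kernel.const (Fin n → X) (Measure.dirac (1 : ℝ≥0))) where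
  markov := inferInstance
  dp := fun x x' _ S _ => by
    simp only [Kernel.const_apply]
    exact le_mul_of_one_le_left' (by rw [ENNReal.one_le_ofReal]; exact Real.one_le_exp hε)
  expectation_le_one := by
    rw [Measure.const_comp]
    simp

/-- The optimal e-power at sample size `n`, over the e-variables with integrable logarithm. -/
noncomputable def optLog (ε : ℝ) (Q P : Measure X) (n : ℕ) : ℝ :=
  sSup {r | ∃ κ : Kernel (Fin n → X) ℝ≥0, IsDPEVariable ε P κ ∧
    LogIntegrable (κ ∘ₘ Measure.pi fun _ => Q) ∧
    ∫ y, Real.log y ∂(κ ∘ₘ Measure.pi fun _ => Q) = r}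

variable [IsProbabilityMeasure P] [IsProbabilityMeasure Q]

lemma logIntegrable_const_one :
    LogIntegrable (Kernel.const (Fin n → X) (Measure.dirac (1 : ℝ≥0)) ∘ₘ
      Measure.pi fun _ => Q) := by
  rw [Measure.const_comp]
  simp only [measure_univ, one_smul]
  refine ⟨?_, integrable_dirac (by simp)⟩
  rw [ae_dirac_iff measurableSet_Ioi]
  exact one_pos

lemma IsDPEVariable.integral_log_le {κ : Kernel (Fin n → X) ℝ≥0} (hκ : IsDPEVariable ε P κ)
    (hl : LogIntegrable (κ ∘ₘ Measure.pi fun _ => Q)) :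
    ∫ y, Real.log y ∂(κ ∘ₘ Measure.pi fun _ => Q) ≤ n * ε := by
  have := hκ.markov
  exact hl.integral_le (hκ.dp.lintegral_comp_pi_le hκ.expectation_le_one)

lemma IsDPEVariable.integral_log_le_optLog {κ : Kernel (Fin n → X) ℝ≥0}
    (hκ : IsDPEVariable ε P κ) (hl : LogIntegrable (κ ∘ₘ Measure.pi fun _ => Q)) :
    ∫ y, Real.log y ∂(κ ∘ₘ Measure.pi fun _ => Q) ≤ optLog ε Q P n := by
  refine le_csSup ⟨n * ε, ?_⟩ ⟨κ, hκ, hl, rfl⟩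
  rintro r ⟨κ, hκ, hl, rfl⟩
  exact hκ.integral_log_le hl

lemma optLog_le_of_forall (hε : 0 ≤ ε) {b : ℝ}
    (h : ∀ κ : Kernel (Fin n → X) ℝ≥0, IsDPEVariable ε P κ →
      LogIntegrable (κ ∘ₘ Measure.pi fun _ => Q) →
      ∫ y, Real.log y ∂(κ ∘ₘ Measure.pi fun _ => Q) ≤ b) : optLog ε Q P n ≤ b := by
  refine csSup_le ⟨_, _, isDPEVariable_const_one hε, logIntegrable_const_one, rfl⟩ ?_
  rintro r ⟨κ, hκ, hl, rfl⟩
  exact h κ hκ hl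

lemma optLog_le (hε : 0 ≤ ε) : optLog ε Q P n ≤ n * ε :=
  optLog_le_of_forall hε fun _ hκ hl => hκ.integral_log_le hl

lemma optLog_nonneg (hε : 0 ≤ ε) : 0 ≤ optLog ε Q P n := by
  have h := (isDPEVariable_const_one (n := n) (P := P) hε).integral_log_le_optLog (Q := Q)
    logIntegrable_const_one
  rw [Measure.const_comp] at h
  simpa using h

lemma exists_lt_integral_log (hε : 0 ≤ ε) {b : ℝ} (hb : b < optLog ε Q P n) :
    ∃ κ : Kernel (Fin n → X) ℝ≥0, IsDPEVariable ε P κ ∧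
      LogIntegrable (κ ∘ₘ Measure.pi fun _ => Q) ∧
      b < ∫ y, Real.log y ∂(κ ∘ₘ Measure.pi fun _ => Q) := by
  by_contra! h
  exact absurd (optLog_le_of_forall hε fun κ hκ hl => h κ hκ hl) (not_le.2 hb)

/-- E-variables with e-power `-∞` do not affect the supremum, and all others have an integrable
logarithm, so the extended-real supremum is a real one. -/
lemma rateAt_eq (hε : 0 ≤ ε) (hn : n ≠ 0) :
    rateAt ε Q P n = ((optLog ε Q P n / n : ℝ) : EReal) := by
  have hn0 : (0 : ℝ) < n := by positivity
  have hnE : (0 : EReal) ≤ (n : EReal) := by positivity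
  have hdiv (r : ℝ) : (r : EReal) / (n : EReal) = ((r / n : ℝ) : EReal) := by
    rw [EReal.coe_div, EReal.coe_coe_eq_natCast]
  have hle : rateAt ε Q P n ≤ ((optLog ε Q P n / n : ℝ) : EReal) := by
    refine iSup₂_le fun κ hκ => ?_
    by_cases hbot : ePower Q κ = ⊥
    · rw [hbot, EReal.bot_div_of_pos_ne_top (by exact_mod_cast hn0) (EReal.natCast_ne_top n)]
      exact bot_le
    · have hl := logIntegrable_of_eExp_ne_bot (ne_top_of_le_ne_top ENNReal.ofReal_ne_top
        (hκ.dp.lintegral_comp_pi_le (Q := Q) hκ.expectation_le_one)) hbot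
      rw [ePower, hl.eExp_eq, hdiv, EReal.coe_le_coe_iff]
      gcongr
      exact hκ.integral_log_le_optLog hl
  have hge : ∀ κ : Kernel (Fin n → X) ℝ≥0, IsDPEVariable ε P κ →
      LogIntegrable (κ ∘ₘ Measure.pi fun _ => Q) →
      (((∫ y, Real.log y ∂(κ ∘ₘ Measure.pi fun _ => Q)) / n : ℝ) : EReal) ≤ rateAt ε Q P n := by
    intro κ hκ hl
    rw [← hdiv, ← hl.eExp_eq]
    exact le_iSup₂_of_le (f := fun (κ : Kernel (Fin n → X) ℝ≥0) (_ : IsDPEVariable ε P κ) =>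
      ePower Q κ / (n : EReal)) κ hκ le_rfl
  refine le_antisymm hle ?_
  have htop : rateAt ε Q P n ≠ ⊤ := ne_top_of_le_ne_top (EReal.coe_ne_top _) hle
  have hbot : rateAt ε Q P n ≠ ⊥ := ne_bot_of_le_ne_bot (EReal.coe_ne_bot _)
    (hge _ (isDPEVariable_const_one hε) logIntegrable_const_one)
  lift rateAt ε Q P n to ℝ using ⟨htop, hbot⟩ with t
  rw [EReal.coe_le_coe_iff, div_le_iff₀ hn0]
  refine optLog_le_of_forall hε fun κ hκ hl => ?_
  rw [← div_le_iff₀ hn0]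
  exact EReal.coe_le_coe_iff.1 (hge κ hκ hl)

/-- Stopping early and continuing optimally on the remaining records is no better than the
optimum at the full sample size. -/
lemma IsStoppedEVariable.add_integral_optLog_le (hε : 0 ≤ ε)
    {K : Kernel (Fin n → X) (ℕ × ℝ≥0)} (hK : IsStoppedEVariable ε P K)
    (hlog : LogIntegrable ((K ∘ₘ Measure.pi (fun _ : Fin n => Q)).map Prod.snd)) :
    ∫ y, Real.log y ∂((K ∘ₘ Measure.pi (fun _ : Fin n => Q)).map Prod.snd) +
      ∫ p, optLog ε Q P (n - p.1) ∂(K ∘ₘ Measure.pi (fun _ : Fin n => Q)) ≤ optLog ε Q P n := by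
  have := hK.markov
  refine le_of_forall_pos_le_add fun δ hδ => ?_
  -- The supremum need not be attained: a `δ`-optimal e-variable is fixed for every possible number
  -- of remaining records.
  choose κ hκ hl hlt using fun m : ℕ =>
    exists_lt_integral_log (n := m) (P := P) (Q := Q) hε (sub_lt_self (optLog ε Q P m) hδ)
  have := fun m => (hκ m).markov
  obtain ⟨hli, heq⟩ := logIntegrable_compose hK hlog hl
  have hmain := (hK.compose hκ).integral_log_le_optLog hli
  rw [heq] at hmain
  have hmono := integral_mono (μ := K ∘ₘ Measure.pi (fun _ : Fin n => Q))
    (integrable_comp_fst_sub (n := n) fun m => optLog ε Q P m - δ)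
    (integrable_comp_fst_sub (n := n)
      fun m => ∫ y, Real.log y ∂(κ m ∘ₘ Measure.pi fun _ => Q))
    fun p => (hlt (n - p.1)).le
  rw [integral_sub (integrable_comp_fst_sub _) (integrable_const _)] at hmono
  simp only [integral_const, probReal_univ, one_smul] at hmono
  linarith

lemma comap_comp_measure {α β γ : Type*} [MeasurableSpace α] [MeasurableSpace β]
    [MeasurableSpace γ] (κ : Kernel β γ) {g : α → β} (hg : Measurable g) (μ : Measure α) :
    κ.comap g hg ∘ₘ μ = κ ∘ₘ (μ.map g) := by
  ext S hS
  rw [Measure.bind_apply hS (Kernel.aemeasurable _), Measure.bind_apply hS κ.aemeasurable,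
    lintegral_map (κ.measurable_coe hS) hg]
  rfl

lemma map_castLE_pi {m : ℕ} (hmn : m ≤ n) :
    (Measure.pi fun _ : Fin n => Q).map (fun x (j : Fin m) => x (Fin.castLE hmn j)) =
      Measure.pi fun _ => Q :=
  map_comp_pi (Fin.castLE_injective hmn) Q

/-- The mechanism that stops after `m` records and reports the output of `κ` on them. -/
noncomputable def stopAt {m : ℕ} (hmn : m ≤ n) (κ : Kernel (Fin m → X) ℝ≥0) :
    Kernel (Fin n → X) (ℕ × ℝ≥0) :=
  (κ.comap (fun (x : Fin n → X) (j : Fin m) => x (Fin.castLE hmn j)) (by fun_prop)).map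
    fun y => (m, y)

lemma stopAt_comp_pi {m : ℕ} (hmn : m ≤ n) (κ : Kernel (Fin m → X) ℝ≥0) :
    stopAt hmn κ ∘ₘ Measure.pi (fun _ : Fin n => Q) =
      (κ ∘ₘ Measure.pi (fun _ : Fin m => Q)).map fun y => (m, y) := by
  rw [stopAt, ← Measure.map_comp _ _ (by fun_prop), comap_comp_measure, map_castLE_pi]

lemma isStoppedEVariable_stopAt (hε : 0 ≤ ε) {m : ℕ} (hmn : m ≤ n) {κ : Kernel (Fin m → X) ℝ≥0}
    (hκ : IsDPEVariable ε P κ) :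
    IsStoppedEVariable ε P (stopAt hmn κ) := by
  have := hκ.markov
  have hf : Measurable fun y : ℝ≥0 => (m, y) := by fun_prop
  refine ⟨Kernel.IsMarkovKernel.map _ hf, IsDP.map ?_ hf, ?_, ?_⟩
  · rintro x x' ⟨i, hi⟩ S hS
    rw [Kernel.comap_apply, Kernel.comap_apply]
    by_cases him : (i : ℕ) < m
    · refine hκ.dp _ _ ⟨⟨i, him⟩, fun j hj => hi _ ?_⟩ S hS
      simpa [Fin.ext_iff] using hj
    · rw [show (fun j : Fin m => x (Fin.castLE hmn j)) = fun j => x' (Fin.castLE hmn j) from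
        funext fun j => hi _ (by rintro rfl; exact him j.2)]
      exact le_mul_of_one_le_left' (by rw [ENNReal.one_le_ofReal]; exact Real.one_le_exp hε)
  · intro k x x' h S hS hSk
    rw [stopAt, Kernel.map_apply' _ hf _ hS, Kernel.map_apply' _ hf _ hS, Kernel.comap_apply,
      Kernel.comap_apply]
    by_cases hmk : m ≤ k
    · rw [show (fun j : Fin m => x (Fin.castLE hmn j)) = fun j => x' (Fin.castLE hmn j) from
        funext fun j => h _ (lt_of_lt_of_le j.2 hmk)]
    · have : (fun y : ℝ≥0 => (m, y)) ⁻¹' S = ∅ := by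
        ext y
        simp only [Set.mem_preimage, Set.mem_empty_iff_false, iff_false]
        exact fun hy => hmk (hSk _ hy)
      simp [this]
  · rw [stopAt_comp_pi, lintegral_map (by fun_prop) hf]
    exact hκ.expectation_le_one

/-- The case of the deterministic stopping time `m`. -/
lemma optLog_add_le (hε : 0 ≤ ε) (m k : ℕ) :
    optLog ε Q P m + optLog ε Q P k ≤ optLog ε Q P (m + k) := by
  rw [← le_sub_iff_add_le]
  refine optLog_le_of_forall hε fun κ hκ hl => ?_
  rw [le_sub_iff_add_le]
  have := hκ.markov
  have hmk : m ≤ m + k := Nat.le_add_right m k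
  have hf : Measurable fun y : ℝ≥0 => (m, y) := by fun_prop
  have hmap : (stopAt hmk κ ∘ₘ Measure.pi (fun _ : Fin (m + k) => Q)).map Prod.snd =
      κ ∘ₘ Measure.pi (fun _ : Fin m => Q) := by
    rw [stopAt_comp_pi, Measure.map_map measurable_snd hf]
    exact Measure.map_id
  have h := (isStoppedEVariable_stopAt hε hmk hκ).add_integral_optLog_le hε (Q := Q)
    (by rw [hmap]; exact hl)
  rw [hmap, stopAt_comp_pi, integral_map (f := fun p : ℕ × ℝ≥0 => optLog ε Q P (m + k - p.1))
    hf.aemeasurable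
    ((measurable_from_nat (f := fun j => optLog ε Q P (m + k - j))).comp
      measurable_fst).aestronglyMeasurable] at h
  simpa using h

/-- Fekete's lemma for the optimal e-power. -/
lemma exists_tendsto_optLog_div (hε : 0 ≤ ε) :
    ∃ R : ℝ, 0 ≤ R ∧ Tendsto (fun n : ℕ => optLog ε Q P n / n) atTop (𝓝 R) := by
  have hsub : Subadditive fun n => -optLog ε Q P n := fun m k => by
    have := optLog_add_le (P := P) (Q := Q) hε m k
    linarith
  have hbdd : BddBelow (Set.range fun n : ℕ => -optLog ε Q P n / n) := by
    refine ⟨-ε, ?_⟩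
    rintro _ ⟨n, rfl⟩
    rcases Nat.eq_zero_or_pos n with rfl | hn
    · simpa using hε
    · have hn' : (0 : ℝ) < n := by positivity
      have := optLog_le (n := n) (P := P) (Q := Q) hε
      simp only
      rw [le_div_iff₀ hn']
      linarith
  have h := (hsub.tendsto_lim hbdd).neg
  simp only [neg_div, neg_neg] at h
  exact ⟨_, ge_of_tendsto' h fun n => div_nonneg (optLog_nonneg hε) (Nat.cast_nonneg n), h⟩

lemma tendsto_rateAt (hε : 0 ≤ ε) {R : ℝ}
    (hR : Tendsto (fun n : ℕ => optLog ε Q P n / n) atTop (𝓝 R)) :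
    Tendsto (rateAt ε Q P) atTop (𝓝 (R : EReal)) := by
  refine (continuous_coe_real_ereal.tendsto R |>.comp hR).congr' ?_
  filter_upwards [eventually_ne_atTop 0] with n hn
  exact (rateAt_eq hε hn).symm

end Rate

/-! ### Stopped streams as batch mechanisms, and the renewal inequality -/

section Streams

variable {X O : Type*} [MeasurableSpace X] [MeasurableSpace O]

/-- Optional stopping for e-processes at bounded stopping times. -/
lemma IsEprocess.lintegral_stopped_le_one {Ω : Type*} {m : MeasurableSpace Ω} {𝓕 : Filtration ℕ m}
    {μ : Measure Ω} [IsFiniteMeasure μ] {E : ℕ → Ω → ℝ≥0} (hE : IsEprocess 𝓕 μ E)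
    {τ : Ω → ℕ} (hτ : IsStoppingTime 𝓕 fun ω => ((τ ω : ℕ) : WithTop ℕ)) {b : ℕ}
    (hb : ∀ ω, τ ω ≤ b) : ∫⁻ ω, (E (τ ω) ω : ℝ≥0∞) ∂μ ≤ 1 := by
  obtain ⟨M, hM, hEM⟩ := hE.dominated
  have hb' : ∀ ω, ((τ ω : ℕ) : WithTop ℕ) ≤ b := fun ω => by exact_mod_cast hb ω
  have hint := integrable_stoppedValue ℕ hτ hM.supermartingale.integrable hb'
  -- Optional stopping for the submartingale `-M` between the times `0` and `τ`.
  have hle := hM.supermartingale.neg.expected_stoppedValue_mono (isStoppingTime_const 𝓕 0) hτ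
    (fun ω => zero_le) hb'
  have hsv : stoppedValue M (fun ω => ((τ ω : ℕ) : WithTop ℕ)) = fun ω => M (τ ω) ω := rfl
  have h0 : stoppedValue (-M) (fun _ : Ω => ((0 : ℕ) : WithTop ℕ)) = fun ω => -M 0 ω := rfl
  have hn : stoppedValue (-M) (fun ω => ((τ ω : ℕ) : WithTop ℕ)) = fun ω => -M (τ ω) ω := rfl
  rw [hn] at hle
  erw [h0] at hle
  rw [integral_neg, integral_neg] at hle
  rw [hsv] at hint
  calc ∫⁻ ω, (E (τ ω) ω : ℝ≥0∞) ∂μ ≤ ∫⁻ ω, ENNReal.ofReal (M (τ ω) ω) ∂μ := by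
        refine lintegral_mono_ae (hEM.mono fun ω hω => ?_)
        rw [← ENNReal.ofReal_coe_nnreal]
        exact ENNReal.ofReal_le_ofReal (hω _)
    _ = ENNReal.ofReal (∫ ω, M (τ ω) ω ∂μ) :=
        (ofReal_integral_eq_lintegral_ofReal hint (hM.nonneg.mono fun ω hω => hω _)).symm
    _ ≤ 1 := by
        rw [ENNReal.ofReal_le_one]
        linarith [hM.initial_le_one]

/-- An event about the stopped pair that forces `τ ≤ t` is decided by time `t`. This lets causality
of the stream be applied to the stopped output. -/
lemma measurableSet_stopped {Ω Z : Type*} {m : MeasurableSpace Ω} [MeasurableSpace Z]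
    {𝓕 : Filtration ℕ m} {E : ℕ → Ω → Z} (hE : ∀ t, Measurable[𝓕 t] (E t))
    {τ : Ω → ℕ} (hτ : IsStoppingTime 𝓕 fun ω => ((τ ω : ℕ) : WithTop ℕ))
    {S : Set (ℕ × Z)} (hS : MeasurableSet S) (t : ℕ) (hSt : ∀ ω, (τ ω, E (τ ω) ω) ∈ S → τ ω ≤ t) :
    MeasurableSet[𝓕 t] ((fun ω => (τ ω, E (τ ω) ω)) ⁻¹' S) := by
  have : (fun ω => (τ ω, E (τ ω) ω)) ⁻¹' S =
      ⋃ k ∈ Set.Iic t, {ω | ((τ ω : ℕ) : WithTop ℕ) = k} ∩ E k ⁻¹' (Prod.mk k ⁻¹' S) := by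
    ext ω
    simp only [Set.mem_preimage, Set.mem_iUnion, Set.mem_inter_iff, Set.mem_ofPred_eq, Set.mem_Iic,
      exists_prop]
    constructor
    · exact fun h => ⟨τ ω, hSt ω h, rfl, h⟩
    · rintro ⟨k, -, hk, h⟩
      obtain rfl : τ ω = k := by exact_mod_cast hk
      exact h
  rw [this]
  refine MeasurableSet.biUnion (Set.to_countable _) fun k hk => ?_
  exact 𝓕.mono hk _ ((hτ.measurableSet_eq k).inter (hE k (measurable_prodMk_left hS)))

/-- Extend a dataset of size `n` to a stream by repeating a fixed record. -/
def pad {X : Type*} (n : ℕ) (x₀ : X) (x : Fin n → X) : ℕ → X :=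
  fun i => if h : i < n then x ⟨i, h⟩ else x₀

@[fun_prop]
lemma measurable_pad (n : ℕ) (x₀ : X) : Measurable (pad n x₀) := by
  refine measurable_pi_lambda _ fun i => ?_
  by_cases h : i < n
  · simpa only [pad, h, dite_true] using measurable_pi_apply _
  · simp only [pad, h, dite_false, measurable_const]

/-- The batch mechanism that runs a stream mechanism up to the stopping time `τ` and reports the
stopping time and the value of `E` at that time. -/
noncomputable def streamStop (κ : Kernel (ℕ → X) (ℕ → O)) (E : ℕ → (ℕ → O) → ℝ≥0)
    (τ : (ℕ → O) → ℕ) (n : ℕ) (x₀ : X) : Kernel (Fin n → X) (ℕ × ℝ≥0) :=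
  (κ.comap (pad n x₀) (measurable_pad n x₀)).map fun ω => (τ ω, E (τ ω) ω)

variable {P Q : Measure X} [IsProbabilityMeasure P] [IsProbabilityMeasure Q] {ε : ℝ}
  {κ : Kernel (ℕ → X) (ℕ → O)}
  {𝓕 : Filtration ℕ (MeasurableSpace.pi : MeasurableSpace (ℕ → O))}
  {E : ℕ → (ℕ → O) → ℝ≥0} {τ : (ℕ → O) → ℕ} {b n : ℕ}

lemma IsDPEprocess.measurable_stopped (hE : IsDPEprocess ε P κ 𝓕 E)
    (hτ : IsStoppingTime 𝓕 fun ω => ((τ ω : ℕ) : WithTop ℕ)) (hb : ∀ ω, τ ω ≤ b) :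
    Measurable fun ω => (τ ω, E (τ ω) ω) := fun _ hS =>
  𝓕.le b _ (measurableSet_stopped hE.eprocess.adapted hτ hS b fun ω _ => hb ω)

/-- Up to a stopping time that is at most `n`, the output stream on i.i.d. records is the output
of the batch mechanism on `n` i.i.d. records. -/
lemma IsDPEprocess.streamStop_comp_pi (hE : IsDPEprocess ε P κ 𝓕 E)
    (hτ : IsStoppingTime 𝓕 fun ω => ((τ ω : ℕ) : WithTop ℕ)) (hb : ∀ ω, τ ω ≤ b) (hbn : b ≤ n)
    (x₀ : X) :
    streamStop κ E τ n x₀ ∘ₘ Measure.pi (fun _ : Fin n => Q) =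
      (outputLaw κ Q).map fun ω => (τ ω, E (τ ω) ω) := by
  have hout := hE.measurable_stopped hτ hb
  rw [streamStop, ← Measure.map_comp _ _ hout, comap_comp_measure, outputLaw]
  ext S hS
  have hS' := hout hS
  rw [Measure.map_apply hout hS, Measure.map_apply hout hS,
    Measure.bind_apply hS' κ.aemeasurable, Measure.bind_apply hS' κ.aemeasurable,
    lintegral_map (κ.measurable_coe hS') (measurable_pad n x₀), ← map_comp_infinitePi_pi,
    lintegral_map (f := fun x => κ (pad n x₀ x) _)
      ((κ.measurable_coe hS').comp (measurable_pad n x₀)) (by fun_prop)]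
  refine lintegral_congr fun x => ?_
  -- The event belongs to time `n`, so replacing all later records by `x₀` does not change its
  -- probability.
  refine hE.causal n _ _ (fun i hi => by simp [pad, hi]) _ ?_
  exact hE.filtration_le n _ (measurableSet_stopped hE.eprocess.adapted hτ hS n
    fun ω _ => (hb ω).trans hbn)

lemma IsDPEprocess.isStoppedEVariable (hE : IsDPEprocess ε P κ 𝓕 E)
    (hτ : IsStoppingTime 𝓕 fun ω => ((τ ω : ℕ) : WithTop ℕ)) (hb : ∀ ω, τ ω ≤ b) (hbn : b ≤ n)
    (x₀ : X) : IsStoppedEVariable ε P (streamStop κ E τ n x₀) := by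
  have := hE.markov
  have hout := hE.measurable_stopped hτ hb
  have : IsProbabilityMeasure (outputLaw κ P) := by unfold outputLaw; infer_instance
  refine ⟨Kernel.IsMarkovKernel.map _ hout, IsDP.map ?_ hout, ?_, ?_⟩
  · rintro x x' ⟨i, hi⟩ S hS
    refine hE.dp _ _ ⟨i, fun j hj => ?_⟩ S hS
    by_cases hjn : j < n
    · simpa [pad, hjn] using hi ⟨j, hjn⟩ (by simpa [Fin.ext_iff] using hj)
    · simp [pad, hjn]
  · intro m x x' h S hS hSm
    rw [streamStop, Kernel.map_apply' _ hout _ hS, Kernel.map_apply' _ hout _ hS]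
    refine hE.causal m _ _ (fun i hi => ?_) _ (hE.filtration_le m _
      (measurableSet_stopped hE.eprocess.adapted hτ hS m fun ω hω => hSm _ hω))
    by_cases hin : i < n
    · simpa [pad, hin] using h ⟨i, hin⟩ hi
    · simp [pad, hin]
  · rw [hE.streamStop_comp_pi hτ hb hbn, lintegral_map (by fun_prop) hout]
    exact hE.eprocess.lintegral_stopped_le_one hτ hb

lemma integrable_fst_of_le {μ : Measure (ℕ × ℝ≥0)} [IsFiniteMeasure μ] {b : ℕ}
    (hb : ∀ᵐ p ∂μ, p.1 ≤ b) : Integrable (fun p : ℕ × ℝ≥0 => (p.1 : ℝ)) μ := by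
  refine Integrable.of_bound (C := b)
    ((measurable_from_nat (f := fun m : ℕ => (m : ℝ))).comp measurable_fst).aestronglyMeasurable
    (hb.mono fun p hp => ?_)
  simpa using hp

/-- A stopped mechanism with mean e-power `L > 0` and mean stopping time `T` forces growth at
rate `L / T`. -/
lemma mul_sub_le_of_recursion {a : ℕ → ℝ} (ha : ∀ n, 0 ≤ a n) {μ : Measure (ℕ × ℝ≥0)}
    [IsProbabilityMeasure μ] {b : ℕ} (hb : ∀ᵐ p ∂μ, p.1 ≤ b) {L : ℝ} (hL : 0 < L)
    (hT : 0 < ∫ p, (p.1 : ℝ) ∂μ)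
    (hrec : ∀ n, b ≤ n → L + ∫ p, a (n - p.1) ∂μ ≤ a n) (n : ℕ) :
    L / (∫ p, (p.1 : ℝ) ∂μ) * ((n : ℝ) - b) ≤ a n := by
  set T := ∫ p, (p.1 : ℝ) ∂μ with hTdef
  set c := L / T
  have hc : 0 < c := div_pos hL hT
  have hfst := integrable_fst_of_le hb
  induction n using Nat.strong_induction_on with
  | _ n ih =>
    rcases lt_or_ge n b with hnb | hbn
    · refine le_trans ?_ (ha n)
      have : (n : ℝ) ≤ b := by exact_mod_cast hnb.le
      exact mul_nonpos_of_nonneg_of_nonpos hc.le (by linarith)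
    -- Plain induction fails because the stopping time may be `0` with positive probability, and
    -- then `a n` itself appears in the integral. The deficit `d < 0` at `n` is therefore played
    -- against the recursion.
    by_contra! hlt
    set d := a n - c * ((n : ℝ) - b) with hd
    have hdneg : d < 0 := by linarith
    have hb0 : (0 : ℝ) < b := by
      rw [Nat.cast_pos, Nat.pos_iff_ne_zero]
      rintro rfl
      rw [hTdef, integral_eq_zero_of_ae (hb.mono fun p hp => by simpa using hp)] at hT
      exact lt_irrefl _ hT
    -- The lower bound is affine in the stopping time: it equals `a n` at `0`, and its deficit `d *
    -- (1 - p.1 / b)` fades to zero at `b`. Integrated, the recursion leaves `-(d / b) * T ≤ 0`,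
    -- which is absurd for `d < 0 < T`.
    have hpt : ∀ᵐ p ∂μ, c * ((n : ℝ) - b) + d - (c + d / b) * (p.1 : ℝ) ≤ a (n - p.1) := by
      filter_upwards [hb] with p hp
      rcases Nat.eq_zero_or_pos p.1 with h0 | h0
      · simp [h0, hd]
      · have hpn : p.1 ≤ n := hp.trans hbn
        have h1 := ih (n - p.1) (by omega)
        rw [Nat.cast_sub hpn] at h1
        have h2 : (p.1 : ℝ) / b ≤ 1 := by
          rw [div_le_one hb0]
          exact_mod_cast hp
        have h3 : d * (1 - p.1 / b) ≤ 0 := mul_nonpos_of_nonpos_of_nonneg hdneg.le (by linarith)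
        have h4 : c * ((n : ℝ) - b) + d - (c + d / b) * (p.1 : ℝ) =
            c * ((n : ℝ) - p.1 - b) + d * (1 - p.1 / b) := by ring
        linarith
    have hI := integral_mono_ae ((integrable_const _).sub (hfst.const_mul _))
      (integrable_comp_fst_sub a) hpt
    rw [integral_sub' (integrable_const _) (hfst.const_mul _), integral_const_mul, ← hTdef] at hI
    simp only [integral_const, probReal_univ, one_smul] at hI
    have hr := hrec n hbn
    have hcT : c * T = L := div_mul_cancel₀ _ hT.ne'
    have hdT : d / b * T < 0 := mul_neg_of_neg_of_pos (div_neg_of_neg_of_pos hdneg hb0) hT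
    have : (c + d / b) * T = L + d / b * T := by rw [add_mul, hcT]
    linarith

end Streams

/-! ### The bound at stopping times -/

variable {X O : Type*} [MeasurableSpace X] [MeasurableSpace O]

lemma isStoppingTime_min_nat {Ω : Type*} {m : MeasurableSpace Ω} {𝓕 : Filtration ℕ m}
    {N : Ω → ℕ} (hN : IsStoppingTime 𝓕 fun ω => ((N ω : ℕ) : WithTop ℕ)) (b : ℕ) :
    IsStoppingTime 𝓕 fun ω => ((min (N ω) b : ℕ) : WithTop ℕ) := by
  convert! hN.min_const b using 1

lemma eExp_congr {Ω : Type*} [MeasurableSpace Ω] {μ : Measure Ω} {f g : Ω → EReal}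
    (h : f =ᵐ[μ] g) : eExp μ f = eExp μ g := by
  have h1 : (fun ω => (f ω).toENNReal) =ᵐ[μ] fun ω => (g ω).toENNReal :=
    h.fun_comp EReal.toENNReal
  have h2 : (fun ω => (-f ω).toENNReal) =ᵐ[μ] fun ω => (-g ω).toENNReal :=
    h.fun_comp fun a => (-a).toENNReal
  rw [eExp, eExp, lintegral_congr_ae h1, lintegral_congr_ae h2]

lemma eExp_map {Ω Z : Type*} [MeasurableSpace Ω] [MeasurableSpace Z] {μ : Measure Ω} {g : Ω → Z}
    (hg : Measurable g) {f : Z → EReal} (hf : Measurable f) :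
    eExp (μ.map g) f = eExp μ (f ∘ g) := by
  rw [eExp, eExp, lintegral_map (by fun_prop) hg, lintegral_map (by fun_prop) hg]
  rfl

/-- The bound for stopping times that are bounded everywhere. -/
lemma IsDPEprocess.bound {P Q : Measure X} [IsProbabilityMeasure P] [IsProbabilityMeasure Q]
    {ε : ℝ} (hε : 0 ≤ ε) {κ : Kernel (ℕ → X) (ℕ → O)}
    {𝓕 : Filtration ℕ (MeasurableSpace.pi : MeasurableSpace (ℕ → O))}
    {E : ℕ → (ℕ → O) → ℝ≥0} (hE : IsDPEprocess ε P κ 𝓕 E) {τ : (ℕ → O) → ℕ}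
    (hτ : IsStoppingTime 𝓕 fun ω => ((τ ω : ℕ) : WithTop ℕ)) {b : ℕ} (hb : ∀ ω, τ ω ≤ b)
    {R : ℝ} (hR0 : 0 ≤ R) (hR : Tendsto (fun n : ℕ => optLog ε Q P n / n) atTop (𝓝 R)) :
    ∫⁻ ω, (ENNReal.log (E (τ ω) ω : ℝ≥0∞)).toENNReal ∂(outputLaw κ Q) ≠ ∞ ∧
    eExp (outputLaw κ Q) (fun ω => ENNReal.log (E (τ ω) ω : ℝ≥0∞)) ≤
      (((∫ ω, (τ ω : ℝ) ∂(outputLaw κ Q)) * R : ℝ) : EReal) := by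
  obtain ⟨x₀⟩ := nonempty_of_isProbabilityMeasure P
  have := hE.markov
  have hout := hE.measurable_stopped hτ hb
  have hEτ : Measurable fun ω => E (τ ω) ω := measurable_snd.comp hout
  have : IsProbabilityMeasure (outputLaw κ Q) := by unfold outputLaw; infer_instance
  set μ := (outputLaw κ Q).map fun ω => (τ ω, E (τ ω) ω) with hμ
  have hμp : IsProbabilityMeasure μ := Measure.isProbabilityMeasure_map hout.aemeasurable
  have hsnd : μ.map Prod.snd = (outputLaw κ Q).map fun ω => E (τ ω) ω :=
    Measure.map_map measurable_snd hout
  have hK (n : ℕ) (hbn : b ≤ n) := hE.isStoppedEVariable hτ hb hbn x₀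
  have hlaw (n : ℕ) (hbn : b ≤ n) := hE.streamStop_comp_pi (Q := Q) hτ hb hbn x₀
  have hfin : ∫⁻ y, (y : ℝ≥0∞) ∂(μ.map Prod.snd) ≤ ENNReal.ofReal (Real.exp (b * ε)) := by
    rw [lintegral_map (by fun_prop) measurable_snd, hμ, ← hlaw b le_rfl]
    exact (hK b le_rfl).dp.lintegral_comp_pi_le (hK b le_rfl).expectation_le_one
  have hfin' := ne_top_of_le_ne_top ENNReal.ofReal_ne_top hfin
  refine ⟨?_, ?_⟩
  · have h := lintegral_toENNReal_log_ne_top hfin'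
    rwa [hsnd, lintegral_map (by fun_prop) hEτ] at h
  have hmap : eExp (outputLaw κ Q) (fun ω => ENNReal.log (E (τ ω) ω : ℝ≥0∞)) =
      eExp (μ.map Prod.snd) (fun y => ENNReal.log (y : ℝ≥0∞)) := by
    rw [hsnd, eExp_map hEτ (by fun_prop)]
    rfl
  have hT : ∫ ω, (τ ω : ℝ) ∂(outputLaw κ Q) = ∫ p, (p.1 : ℝ) ∂μ := by
    rw [hμ, integral_map (f := fun p : ℕ × ℝ≥0 => (p.1 : ℝ)) hout.aemeasurable
      ((measurable_from_nat (f := fun m : ℕ => (m : ℝ))).comp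
        measurable_fst).aestronglyMeasurable]
  rw [hmap, hT]
  by_cases hbot : eExp (μ.map Prod.snd) (fun y => ENNReal.log (y : ℝ≥0∞)) = ⊥
  · rw [hbot]
    exact bot_le
  have hl := logIntegrable_of_eExp_ne_bot hfin' hbot
  rw [hl.eExp_eq, EReal.coe_le_coe_iff]
  set L := ∫ y : ℝ≥0, Real.log y ∂(μ.map Prod.snd)
  set T := ∫ p : ℕ × ℝ≥0, (p.1 : ℝ) ∂μ
  have hT0 : 0 ≤ T := integral_nonneg fun p => Nat.cast_nonneg _
  have hbμ : ∀ᵐ p ∂μ, p.1 ≤ b :=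
    (ae_map_iff hout.aemeasurable (measurable_fst measurableSet_Iic)).2 (ae_of_all _ hb)
  rcases le_or_gt L 0 with hL | hL
  · exact hL.trans (mul_nonneg hT0 hR0)
  have hrec (n : ℕ) (hbn : b ≤ n) :
      L + ∫ p, optLog ε Q P (n - p.1) ∂μ ≤ optLog ε Q P n := by
    have h := (hK n hbn).add_integral_optLog_le (Q := Q) hε (by rw [hlaw n hbn]; exact hl)
    rwa [hlaw n hbn] at h
  -- If `T = 0`, the process stops at time `0` almost surely, and the recursion at `b` reads `L + a
  -- b ≤ a b`, contradicting `L > 0`.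
  have hTpos : 0 < T := by
    refine lt_of_le_of_ne hT0 fun hTz => ?_
    have hz := (integral_eq_zero_iff_of_nonneg (fun p => Nat.cast_nonneg _)
      (integrable_fst_of_le hbμ)).1 hTz.symm
    have h := hrec b le_rfl
    rw [integral_congr_ae (g := fun _ => optLog ε Q P b) (hz.mono fun p hp => by
      have hp' : p.1 = 0 := by simpa using hp
      simp only [hp', Nat.sub_zero])] at h
    simp only [integral_const, probReal_univ, one_smul] at h
    linarith
  have hgrow := mul_sub_le_of_recursion (a := optLog ε Q P) (fun n => optLog_nonneg hε) hbμ hL hTpos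
    hrec
  have hlim : Tendsto (fun n : ℕ => L / T * (1 - (b : ℝ) / n)) atTop (𝓝 (L / T * (1 - 0))) :=
    ((tendsto_const_div_atTop_nhds_zero_nat (b : ℝ)).const_sub 1).const_mul _
  have hle : L / T * (1 - 0) ≤ R := by
    refine le_of_tendsto_of_tendsto hlim hR ?_
    filter_upwards [eventually_gt_atTop 0] with n hn
    have hn' : (0 : ℝ) < n := by exact_mod_cast hn
    rw [le_div_iff₀ hn']
    refine le_of_eq_of_le ?_ (hgrow n)
    rw [mul_assoc, sub_mul, one_mul, div_mul_cancel₀ _ hn'.ne']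
  rw [sub_zero, mul_one, div_le_iff₀ hTpos] at hle
  rwa [mul_comm]

end DPTest

theorem mainTheorem3 {X O : Type*} [MeasurableSpace X] [MeasurableSpace O]
    (P Q : Measure X) [IsProbabilityMeasure P] [IsProbabilityMeasure Q]
    (ε : ℝ) (hε : 0 ≤ ε)
    (κ : Kernel (ℕ → X) (ℕ → O))
    (𝓕 : Filtration ℕ (MeasurableSpace.pi : MeasurableSpace (ℕ → O)))
    (E : ℕ → (ℕ → O) → ℝ≥0) (hE : DPTest.IsDPEprocess ε P κ 𝓕 E)
    (N : (ℕ → O) → ℕ) (hN : IsStoppingTime 𝓕 (fun ω => ((N ω : ℕ) : WithTop ℕ)))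
    (Nmax : ℕ) (hNmax : ∀ᵐ ω ∂(DPTest.outputLaw κ Q), N ω ≤ Nmax) :
    Tendsto (DPTest.rateAt ε Q P) atTop (𝓝 (DPTest.rate ε Q P)) ∧
    ∫⁻ ω, (ENNReal.log (E (N ω) ω : ℝ≥0∞)).toENNReal ∂(DPTest.outputLaw κ Q) ≠ ∞ ∧
    DPTest.eExp (DPTest.outputLaw κ Q) (fun ω => ENNReal.log (E (N ω) ω : ℝ≥0∞)) ≤
      ((∫ ω, (N ω : ℝ) ∂(DPTest.outputLaw κ Q) : ℝ) : EReal) * DPTest.rate ε Q P := by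
  obtain ⟨R, hR0, hR⟩ := DPTest.exists_tendsto_optLog_div (P := P) (Q := Q) hε
  have hrate := DPTest.tendsto_rateAt hε hR
  have hrate' : DPTest.rate ε Q P = (R : EReal) := hrate.limUnder_eq
  -- Optional stopping takes place under `P`, where `N` need not be bounded. Truncation at `Nmax`
  -- makes it bounded everywhere and changes nothing `Q`-almost surely.
  obtain ⟨h1, h2⟩ := hE.bound hε (DPTest.isStoppingTime_min_nat hN Nmax)
    (fun ω => min_le_right _ _) hR0 hR
  have hmin : ∀ᵐ ω ∂(DPTest.outputLaw κ Q), min (N ω) Nmax = N ω :=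
    hNmax.mono fun ω hω => min_eq_left hω
  rw [hrate']
  refine ⟨hrate, ?_, ?_⟩
  · rwa [lintegral_congr_ae (g := fun ω => (ENNReal.log (E (N ω) ω : ℝ≥0∞)).toENNReal)
      (hmin.mono fun ω hω => by simp only [hω])] at h1
  · rw [DPTest.eExp_congr (g := fun ω => ENNReal.log (E (N ω) ω : ℝ≥0∞))
      (hmin.mono fun ω hω => by simp only [hω]),
      integral_congr_ae (g := fun ω => (N ω : ℝ)) (hmin.mono fun ω hω => by simp only [hω])] at h2
    rwa [← EReal.coe_mul]
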